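/- Let $f:\mathbb R^n\to\mathbb R^n$ and $g:\mathbb R^n\to\mathbb R^{n\times m}$ be locally Lipschitz, and consider $\dot x=f(x)+g(x)u$. For a differentiable $\varphi:\mathbb R^n\to\mathbb R$ write $L_f\varphi=\frac{\partial\varphi}{\partial x}f$ and $L_g\varphi=\frac{\partial\varphi}{\partial x}g$. A function $\alpha:\mathbb R\to\mathbb R$ is of extended class $\mathcal K$ if it is continuous, strictly increasing and $\alpha(0)=0$. Let $\psi:\mathbb R^n\to\mathbb R$ and $L_f\psi$ be continuously differentiable, let $\alpha_1$ be a continuously differentiable function of extended class $\mathcal K$, and put $h=L_f\psi+\alpha_1(\psi)$, $\mathcal S=\{\psi\ge 0\}$, $\mathcal C=\{h\ge 0\}$. Assume that $\psi$ is an OD-HOCBF (optimal-decay high-order control barrier function) of degree $2$ on $\mathcal S\cap\mathcal C$, that is: $\psi$ has relative degree $2$ ($L_g\psi\equiv 0$ and $L_gL_f\psi\not\equiv 0$), and for some $\alpha$ of extended class $\mathcal K$ $$\sup_{u\in\mathbb R^m,\ \omega\ge 0} L_fh(x)+L_gh(x)u+\omega\,\alpha(h(x))>0\qquad\text{for all }x\in\mathcal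 S\cap\mathcal C .$$ Assume also that $\frac{\partial\psi}{\partial x}(x)\ne 0$ whenever $\psi(x)=h(x)=0$. A trajectory is a solution of the differential equation on some $[0,T)$, $0<T\le\infty$, that extends every other solution with the same initial value. We say that it is contained in a set for all time if it lies in the set for all $t\in[0,T)$ and either $T=\infty$ or $\|x(t)\|\to\infty$ as $t\to T$. Then: 1. $\mathcal S\cap\mathcal C$ is a safe set: $\mathcal S\cap\mathcal C\subseteq\mathcal S$, and for every $x_0\in\mathcal S\cap\mathcal C$ there is a control signal $u(t)$, continuous on the interval $[0,T)$ of existence, such that the trajectory of $\dot x=f(x)+g(x)u(t)$ from $x_0$ exists and is contained in $\mathcal S\cap\mathcal C$ for all time. 2. Let $\Gamma\in\mathbb R^{m\times m}$ be symmetric positive definite, $p>0$, $\theta_{\rm d}\ge 0$, let $k_{\rm d}:\mathbb R^n\to\mathbb R^m$ be locally Lipschitz, let $\alpha$ be any locally Lipschitz function of extended class $\mathcal K$, and let $\frac{\partial h}{\partial x}$ be locally Lipschitz. Then the OD-CBF-QP $$\min_{u\in\mathbb R^m,\ \omega\ge 0}\ \tfrac12 (u-k_{\rm d}(x))^\top\Gamma(u-k_{\rm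 d}(x))+\tfrac12 p(\omega-\theta_{\rm d})^2\quad\text{s.t.}\quad L_fh(x)+L_gh(x)u\ge-\omega\,\alpha(h(x)),\ \ \omega\ge\theta_{\rm d}$$ has exactly one minimizer for every $x\in\mathcal S\cap\mathcal C$. If $k:\mathbb R^n\to\mathbb R^m$ and $\theta:\mathbb R^n\to\mathbb R$ are such that $(k(x),\theta(x))$ is a minimizer at every $x$ at which the program is feasible (the values at other points being arbitrary), then $\mathcal S\cap\mathcal C$ is forward invariant for $\dot x=f(x)+g(x)k(x)$: from every $x_0\in\mathcal S\cap\mathcal C$ the trajectory exists and is contained in $\mathcal S\cap\mathcal C$ for all time. -/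

import Mathlib

open Set Filter Topology
open scoped NNReal Matrix

noncomputable section

namespace ODCBF

/-- Euclidean space of dimension `d`. -/
abbrev E (d : ℕ) : Type := EuclideanSpace ℝ (Fin d)

/-! ### Ordinary differential equations, trajectories and invariance -/

/-- The time interval `[0, T)`, where `T` may be `+∞`. -/
def timeInterval (T : EReal) : Set ℝ := {t | 0 ≤ t ∧ (t : EReal) < T}

/-- `x` solves the differential equation `x' = V(t, x)` on `[0, T)`
(with a one-sided derivative at time `0`). -/
def SolvesODE {n : ℕ} (V : ℝ → E n → E n) (T : EReal) (x : ℝ → E n) : Prop :=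
  ∀ t ∈ timeInterval T, HasDerivWithinAt x (V t (x t)) (timeInterval T) t

/-- `x`, on the time interval `[0, T)`, is the trajectory of `x' = V(t, x)` that starts at `x₀`:
a solution that extends every other solution with the same initial value. -/
def IsTrajectory {n : ℕ} (V : ℝ → E n → E n) (x₀ : E n) (T : EReal) (x : ℝ → E n) : Prop :=
  0 < T ∧ x 0 = x₀ ∧ SolvesODE V T x ∧
    ∀ (T' : EReal) (y : ℝ → E n), y 0 = x₀ → SolvesODE V T' y →
      T' ≤ T ∧ EqOn y x (timeInterval T')

/-- The curve `x` on `[0, T)` is contained in `A` for all time: it lies in `A` as long as it is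
defined, and the only way in which it can be defined for a finite time `T = τ` only is that it
escapes to infinity, `‖x t‖ → ∞` as `t → τ`. -/
def RemainsIn {n : ℕ} (A : Set (E n)) (T : EReal) (x : ℝ → E n) : Prop :=
  (∀ t ∈ timeInterval T, x t ∈ A) ∧
    ∀ τ : ℝ, T = (τ : EReal) → Tendsto (fun t => ‖x t‖) (𝓝[<] τ) atTop

/-- Forward invariance of `A` for the autonomous system `x' = F(x)`: from every initial condition
in `A` there is a (unique) trajectory, and it is contained in `A`. -/
def IsForwardInvariant {n : ℕ} (F : E n → E n) (A : Set (E n)) : Prop :=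
  ∀ x₀ ∈ A, ∃ (T : EReal) (x : ℝ → E n),
    IsTrajectory (fun _ => F) x₀ T x ∧ RemainsIn A T x

/-- Control invariance of `A` for `x' = f(x) + g(x) u`: for every initial condition in `A` there
is a (continuous) control signal whose state trajectory is contained in `A`. -/
def IsControlInvariant {n m : ℕ} (f : E n → E n) (g : E n → E m →L[ℝ] E n)
    (A : Set (E n)) : Prop :=
  ∀ x₀ ∈ A, ∃ (T : EReal) (u : ℝ → E m) (x : ℝ → E n),
    ContinuousOn u (timeInterval T) ∧
    IsTrajectory (fun t z => f z + g z (u t)) x₀ T x ∧ RemainsIn A T x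

/-- `A` is a safe set for `x' = f(x) + g(x) u` and the safety constraint set `S`. -/
def IsSafeSet {n m : ℕ} (f : E n → E n) (g : E n → E m →L[ℝ] E n)
    (S A : Set (E n)) : Prop :=
  IsControlInvariant f g A ∧ A ⊆ S

/-- The closed-loop vector field `F(x) = f(x) + g(x) k(x)`. -/
def closedLoop {n m : ℕ} (f : E n → E n) (g : E n → E m →L[ℝ] E n) (k : E n → E m) :
    E n → E n :=
  fun x => f x + g x (k x)

/-! ### Lie derivatives, relative degree, comparison functions -/

/-- The Lie derivative `L_f φ (x) = (∂φ/∂x)(x) · f(x)`. -/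
def lieDeriv {n : ℕ} (f : E n → E n) (φ : E n → ℝ) : E n → ℝ :=
  fun x => fderiv ℝ φ x (f x)

/-- The Lie derivative `L_g φ (x) = (∂φ/∂x)(x) · g(x)`, a row vector, i.e. a linear form on the
input space. -/
def lieDerivInput {n m : ℕ} (g : E n → E m →L[ℝ] E n) (φ : E n → ℝ) : E n → E m →L[ℝ] ℝ :=
  fun x => (fderiv ℝ φ x).comp (g x)

/-- `ψ` has relative degree `r ≥ 1`: `L_g L_f^i ψ ≡ 0` for `0 ≤ i ≤ r - 2`, and
`L_g L_f^(r-1) ψ` is not identically zero. -/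
def HasRelativeDegree {n m : ℕ} (f : E n → E n) (g : E n → E m →L[ℝ] E n) (ψ : E n → ℝ)
    (r : ℕ) : Prop :=
  1 ≤ r ∧ (∀ i : ℕ, i + 2 ≤ r → ∀ x, lieDerivInput g ((lieDeriv f)^[i] ψ) x = 0) ∧
    ∃ x, lieDerivInput g ((lieDeriv f)^[r - 1] ψ) x ≠ 0

/-- Extended class-`𝒦` functions. -/
def IsExtClassK (α : ℝ → ℝ) : Prop :=
  Continuous α ∧ StrictMono α ∧ α 0 = 0

/-! ### Optimal-decay high-order control barrier functions of degree two -/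

/-- The `0`-superlevel set of a function: `S` for `ψ`, and `C` for `h`. -/
def superlevel {n : ℕ} (φ : E n → ℝ) : Set (E n) := {x | 0 ≤ φ x}

/-- The candidate barrier function `h = L_f ψ + α₁(ψ)`. -/
def hocbf {n : ℕ} (f : E n → E n) (ψ : E n → ℝ) (α₁ : ℝ → ℝ) : E n → ℝ :=
  fun x => lieDeriv f ψ x + α₁ (ψ x)

/-- The set `S ∩ C` with `S = {ψ ≥ 0}` and `C = {h ≥ 0}`, `h = L_f ψ + α₁(ψ)`. -/
def safeRegion {n : ℕ} (f : E n → E n) (ψ : E n → ℝ) (α₁ : ℝ → ℝ) : Set (E n) :=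
  superlevel ψ ∩ superlevel (hocbf f ψ α₁)

/-- The optimal-decay condition at `x`:
`sup_{u ∈ ℝ^m, ω ≥ 0} L_f h(x) + L_g h(x) u + ω α(h(x)) > 0`, the supremum being taken in the
extended reals. -/
def ODCondition {n m : ℕ} (f : E n → E n) (g : E n → E m →L[ℝ] E n) (h : E n → ℝ)
    (α : ℝ → ℝ) (x : E n) : Prop :=
  (0 : EReal) < ⨆ (u : E m) (ω : ℝ≥0),
    ((lieDeriv f h x + lieDerivInput g h x u + (ω : ℝ) * α (h x) : ℝ) : EReal)

/-- `ψ` is an optimal-decay high-order control barrier function of degree `2` on `S ∩ C`, with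
`α₁` the function that defines `h` (and hence `C`). -/
def IsODHOCBF {n m : ℕ} (f : E n → E n) (g : E n → E m →L[ℝ] E n) (ψ : E n → ℝ)
    (α₁ : ℝ → ℝ) : Prop :=
  HasRelativeDegree f g ψ 2 ∧ IsExtClassK α₁ ∧
    ∃ α : ℝ → ℝ, IsExtClassK α ∧
      ∀ x ∈ safeRegion f ψ α₁, ODCondition f g (hocbf f ψ α₁) α x

/-! ### The optimal-decay quadratic program -/

/-- The feasible set of the quadratic program at the state `x`: all `(u, ω)` with
`L_f h(x) + L_g h(x) u ≥ -ω α(h(x))`, `ω ≥ 0` and `ω ≥ θd`. -/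
def qpFeasible {n m : ℕ} (f : E n → E n) (g : E n → E m →L[ℝ] E n) (h : E n → ℝ)
    (α : ℝ → ℝ) (θd : ℝ) (x : E n) : Set (E m × ℝ) :=
  {w | -(w.2 * α (h x)) ≤ lieDeriv f h x + lieDerivInput g h x w.1 ∧ 0 ≤ w.2 ∧ θd ≤ w.2}

/-- The cost `½ ‖u - kd(x)‖_Γ² + ½ p (ω - θd)²`, where `‖v‖_Γ² = vᵀ Γ v`. -/
def qpCost {n m : ℕ} (kd : E n → E m) (Γ : Matrix (Fin m) (Fin m) ℝ) (p θd : ℝ) (x : E n)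
    (w : E m × ℝ) : ℝ :=
  (1 / 2) * ((w.1 - kd x).ofLp ⬝ᵥ (Γ *ᵥ (w.1 - kd x).ofLp)) + (1 / 2) * (p * (w.2 - θd) ^ 2)

/-- `w = (u, ω)` is a minimizer of the quadratic program at the state `x`. -/
def IsQPSolution {n m : ℕ} (f : E n → E n) (g : E n → E m →L[ℝ] E n) (h : E n → ℝ)
    (α : ℝ → ℝ) (kd : E n → E m) (Γ : Matrix (Fin m) (Fin m) ℝ) (p θd : ℝ) (x : E n)
    (w : E m × ℝ) : Prop :=
  w ∈ qpFeasible f g h α θd x ∧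
    IsMinOn (qpCost kd Γ p θd x) (qpFeasible f g h α θd x) w

/-- `(k, θ)` is given by the quadratic program, at every state at which the program is feasible.
(Elsewhere the program defines nothing, and the values are arbitrary.) -/
def IsQPController {n m : ℕ} (f : E n → E n) (g : E n → E m →L[ℝ] E n) (h : E n → ℝ)
    (α : ℝ → ℝ) (kd : E n → E m) (Γ : Matrix (Fin m) (Fin m) ℝ) (p θd : ℝ)
    (k : E n → E m) (θ : E n → ℝ) : Prop :=
  ∀ x, (qpFeasible f g h α θd x).Nonempty →
    IsQPSolution f g h α kd Γ p θd x (k x, θ x)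

end ODCBF

end

/-!
Write `S ∩ C` for `safeRegion f ψ α₁` and `h` for `hocbf f ψ α₁`.

*Invariance.* Along `x' = f(x) + g(x) k(x)` the derivative of `ψ` is `L_f ψ = h - α₁(ψ)`, whatever
the feedback, because `L_g ψ = 0`. While `h ≥ 0`, it is nonnegative wherever `ψ < 0`, so `ψ` cannot
become negative before `h` does. The function `h` itself cannot become negative if, near each point
of `S ∩ C`, it does not decrease where it is negative. A condition at the points of `S ∩ C` alone
would not do when the inequality is not strict, so both feedbacks are examined on a neighbourhood;
see `SolvesODE.mem_safeRegion`. No Lipschitz comparison function is needed: the sign of `α` suffices.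

*Control signal.* Where `h = 0` the decay variable is multiplied by `α(0) = 0`, so the
optimal-decay condition gives an input with `L_f h + L_g h u > 0`. A partition of unity patches
these inputs together to a smooth feedback (`exists_smooth_feedback`), and by continuity the strict
inequality persists near the points of `S ∩ C` with `h = 0`. Near the other points `h` is positive.
The control signal is this feedback evaluated along its own closed-loop solution.

*Quadratic program.* The minimizer is explicit: the desired pair, moved along the gradient of the
barrier constraint by the multiplier `max(0, -slack) / gain` (`isQPSolution_iff`). At a point of
`S ∩ C` the slack or the gain is positive, so one of the two is positive on a neighbourhood. There
the program is feasible, the controller is the explicit minimizer and is Lipschitz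
(`lipschitzNear_qpInput`), and the constraint says `h' ≥ -θ α(h) ≥ 0` where `h < 0`.

*Trajectories.* A field that is Lipschitz near the points of a closed set which solutions cannot
leave has, from each point of the set, a solution up to escape to infinity
(`exists_solvesODE_remainsIn`). Such a solution extends all others, because a solution defined beyond
a finite end time would be bounded near it (`RemainsIn.isTrajectory`).
-/

namespace ODCBF

/-! ### Functions that are Lipschitz near a point -/

/-- `F` is Lipschitz on some neighbourhood of `x`: the pointwise form of `LocallyLipschitz`. -/
def LipschitzNear {X Y : Type*} [PseudoEMetricSpace X] [PseudoEMetricSpace Y]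
    (F : X → Y) (x : X) : Prop :=
  ∃ K : ℝ≥0, ∃ s ∈ 𝓝 x, LipschitzOnWith K F s

namespace LipschitzNear

variable {X Y Z : Type*} [PseudoEMetricSpace X] [PseudoEMetricSpace Y] [PseudoEMetricSpace Z]

theorem continuousAt {F : X → Y} {x : X} (hF : LipschitzNear F x) : ContinuousAt F x := by
  obtain ⟨K, s, hs, hK⟩ := hF
  exact hK.continuousOn.continuousAt hs

theorem congr {F G : X → Y} {x : X} (hF : LipschitzNear F x) (h : F =ᶠ[𝓝 x] G) :
    LipschitzNear G x := by
  obtain ⟨K, s, hs, hK⟩ := hF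
  refine ⟨K, s ∩ {y | F y = G y}, inter_mem hs h, fun y hy z hz => ?_⟩
  rw [← hy.2, ← hz.2]
  exact hK hy.1 hz.1

theorem prodMk {F : X → Y} {G : X → Z} {x : X} (hF : LipschitzNear F x)
    (hG : LipschitzNear G x) : LipschitzNear (fun y => (F y, G y)) x := by
  obtain ⟨K, s, hs, hK⟩ := hF
  obtain ⟨K', s', hs', hK'⟩ := hG
  exact ⟨max K K', s ∩ s', inter_mem hs hs',
    (hK.mono inter_subset_left).prodMk (hK'.mono inter_subset_right)⟩

theorem comp {φ : Y → Z} {F : X → Y} {x : X} (hφ : LipschitzNear φ (F x))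
    (hF : LipschitzNear F x) : LipschitzNear (fun y => φ (F y)) x := by
  have hc := hF.continuousAt
  obtain ⟨K, s, hs, hK⟩ := hF
  obtain ⟨K', s', hs', hK'⟩ := hφ
  refine ⟨K' * K, s ∩ F ⁻¹' s', inter_mem hs (hc hs'), ?_⟩
  exact hK'.comp (hK.mono inter_subset_left) (fun y hy => hy.2)

theorem _root_.ContDiffAt.lipschitzNear {V W : Type*} [NormedAddCommGroup V] [NormedSpace ℝ V]
    [NormedAddCommGroup W] [NormedSpace ℝ W] {φ : V → W} {x : V} (hφ : ContDiffAt ℝ 1 φ x) :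
    LipschitzNear φ x :=
  hφ.exists_lipschitzOnWith

theorem clm_apply {X V W : Type*} [PseudoEMetricSpace X]
    [NormedAddCommGroup V] [NormedSpace ℝ V] [NormedAddCommGroup W] [NormedSpace ℝ W]
    {L : X → V →L[ℝ] W} {v : X → V} {x : X} (hL : LipschitzNear L x) (hv : LipschitzNear v x) :
    LipschitzNear (fun y => L y (v y)) x :=
  LipschitzNear.comp (φ := fun q : (V →L[ℝ] W) × V => q.1 q.2)
    (contDiff_fst.clm_apply contDiff_snd).contDiffAt.lipschitzNear (hL.prodMk hv)

theorem add {X V : Type*} [PseudoEMetricSpace X]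
    [NormedAddCommGroup V] [NormedSpace ℝ V]
    {F G : X → V} {x : X} (hF : LipschitzNear F x) (hG : LipschitzNear G x) :
    LipschitzNear (fun y => F y + G y) x :=
  LipschitzNear.comp (φ := fun q : V × V => q.1 + q.2)
    (contDiff_fst.add contDiff_snd).contDiffAt.lipschitzNear (hF.prodMk hG)

theorem mul {X : Type*} [PseudoEMetricSpace X] {F G : X → ℝ} {x : X}
    (hF : LipschitzNear F x) (hG : LipschitzNear G x) : LipschitzNear (fun y => F y * G y) x :=
  LipschitzNear.comp (φ := fun q : ℝ × ℝ => q.1 * q.2)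
    (contDiff_fst.mul contDiff_snd).contDiffAt.lipschitzNear (hF.prodMk hG)

theorem smul {X V : Type*} [PseudoEMetricSpace X] [NormedAddCommGroup V]
    [NormedSpace ℝ V] {F : X → ℝ} {G : X → V} {x : X}
    (hF : LipschitzNear F x) (hG : LipschitzNear G x) : LipschitzNear (fun y => F y • G y) x :=
  LipschitzNear.comp (φ := fun q : ℝ × V => q.1 • q.2)
    (contDiff_fst.smul contDiff_snd).contDiffAt.lipschitzNear (hF.prodMk hG)

theorem div {X : Type*} [PseudoEMetricSpace X] {F G : X → ℝ} {x : X}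
    (hF : LipschitzNear F x) (hG : LipschitzNear G x) (h0 : G x ≠ 0) :
    LipschitzNear (fun y => F y / G y) x :=
  LipschitzNear.comp (φ := fun q : ℝ × ℝ => q.1 / q.2)
    (contDiff_fst.contDiffAt.div contDiff_snd.contDiffAt h0).lipschitzNear (hF.prodMk hG)

theorem clm_comp {X U V W : Type*} [PseudoEMetricSpace X]
    [NormedAddCommGroup U] [NormedSpace ℝ U] [NormedAddCommGroup V] [NormedSpace ℝ V]
    [NormedAddCommGroup W] [NormedSpace ℝ W] {L : X → V →L[ℝ] W} {M : X → U →L[ℝ] V} {x : X}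
    (hL : LipschitzNear L x) (hM : LipschitzNear M x) :
    LipschitzNear (fun y => (L y).comp (M y)) x := by
  have h : ContDiff ℝ 1 (fun q : (V →L[ℝ] W) × (U →L[ℝ] V) => q.1.comp q.2) :=
    isBoundedBilinearMap_comp.contDiff
  have h' := h.contDiffAt.lipschitzNear (x := (L x, M x))
  exact LipschitzNear.comp (F := fun y => (L y, M y)) h' (hL.prodMk hM)

theorem max_zero {X : Type*} [PseudoEMetricSpace X] {F : X → ℝ} {x : X}
    (hF : LipschitzNear F x) : LipschitzNear (fun y => max 0 (F y)) x :=
  LipschitzNear.comp (φ := fun r : ℝ => max 0 r) (LocallyLipschitz.id.const_max 0 (F x)) hF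

end LipschitzNear

theorem lipschitzNear_const {X Y : Type*} [PseudoEMetricSpace X] [PseudoEMetricSpace Y] (c : Y)
    (x : X) : LipschitzNear (fun _ : X => c) x :=
  LocallyLipschitz.const c x

/-! ### Solutions of differential equations: gluing and uniqueness -/

variable {n m : ℕ}

/-- Before time `T`, the interval `[0, T)` is locally the same as `[0, ∞)`. -/
theorem solvesODE_iff {V : ℝ → E n → E n} {T : EReal} {x : ℝ → E n} :
    SolvesODE V T x ↔
      ∀ t : ℝ, 0 ≤ t → (t : EReal) < T → HasDerivWithinAt x (V t (x t)) (Ici 0) t := by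
  have hT : timeInterval T = Ici 0 ∩ {t : ℝ | (t : EReal) < T} := rfl
  have key : ∀ t : ℝ, (t : EReal) < T → ∀ v,
      HasDerivWithinAt x v (timeInterval T) t ↔ HasDerivWithinAt x v (Ici 0) t := by
    intro t ht v
    rw [hT]
    refine hasDerivWithinAt_inter (IsOpen.mem_nhds ?_ ht)
    exact isOpen_lt continuous_coe_real_ereal continuous_const
  exact ⟨fun h t h0 ht => (key t ht _).1 (h t ⟨h0, ht⟩),
    fun h t ht => (key t ht.2 _).2 (h t ht.1 ht.2)⟩

theorem SolvesODE.mono {V : ℝ → E n → E n} {T T' : EReal} {x : ℝ → E n}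
    (h : SolvesODE V T x) (hT : T' ≤ T) : SolvesODE V T' x :=
  solvesODE_iff.2 fun t h0 ht => solvesODE_iff.1 h t h0 (ht.trans_le hT)

theorem SolvesODE.continuousWithinAt {V : ℝ → E n → E n} {T : EReal} {x : ℝ → E n}
    (h : SolvesODE V T x) {t : ℝ} (ht : t ∈ timeInterval T) : ContinuousWithinAt x (Ici 0) t :=
  (solvesODE_iff.1 h t ht.1 ht.2).continuousWithinAt

theorem mem_timeInterval_of_le {T : EReal} {s t : ℝ} (ht : t ∈ timeInterval T) (hs : 0 ≤ s)
    (hst : s ≤ t) : s ∈ timeInterval T :=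
  ⟨hs, (EReal.coe_le_coe_iff.2 hst).trans_lt ht.2⟩

theorem SolvesODE.continuousOn_Icc {V : ℝ → E n → E n} {T : EReal} {x : ℝ → E n}
    (h : SolvesODE V T x) {a b : ℝ} (ha : 0 ≤ a) (hb : b ∈ timeInterval T) :
    ContinuousOn x (Icc a b) := fun _ hs =>
  (h.continuousWithinAt (mem_timeInterval_of_le hb (ha.trans hs.1) hs.2)).mono
    fun _ hr => ha.trans hr.1

theorem SolvesODE.hasDerivWithinAt_Ici {V : ℝ → E n → E n} {T : EReal} {x : ℝ → E n}
    (h : SolvesODE V T x) {t : ℝ} (ht : t ∈ timeInterval T) :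
    HasDerivWithinAt x (V t (x t)) (Ici t) t :=
  (solvesODE_iff.1 h t ht.1 ht.2).mono (Ici_subset_Ici.2 ht.1)

/-- A nonnegative time before `T` is followed by times before `T`. -/
theorem eventually_mem_timeInterval {T : EReal} {t : ℝ} (ht : t ∈ timeInterval T) :
    ∀ᶠ s in 𝓝[≥] t, s ∈ timeInterval T := by
  have h1 : ∀ᶠ s : ℝ in 𝓝 t, (s : EReal) < T :=
    (isOpen_lt continuous_coe_real_ereal continuous_const).mem_nhds ht.2
  filter_upwards [h1.filter_mono nhdsWithin_le_nhds, self_mem_nhdsWithin] with s hs hs'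
  exact ⟨ht.1.trans hs', hs⟩

/-- Continuous induction on the time interval: a relation that is closed, holds initially and
persists for a short while from any time at which it holds, holds for all time. -/
theorem timeInterval_induction {T : EReal} {P : ℝ → Prop}
    (h0 : P 0)
    (hclosed : ∀ b ∈ timeInterval T, IsClosed ({t | P t} ∩ Icc 0 b))
    (hstep : ∀ t ∈ timeInterval T, P t → ∀ᶠ s in 𝓝[≥] t, P s) :
    ∀ t ∈ timeInterval T, P t := by
  intro t ht
  refine (hclosed t ht).Icc_subset_of_forall_mem_nhdsWithin h0 ?_ ⟨ht.1, le_rfl⟩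
  rintro s ⟨hs, hs'⟩
  exact (hstep s (mem_timeInterval_of_le ht hs'.1 hs'.2.le) hs).filter_mono
    (nhdsWithin_mono _ Ioi_subset_Ici_self)

theorem exists_Icc_of_eventually {P : ℝ → Prop} {t : ℝ} (h : ∀ᶠ s in 𝓝[≥] t, P s) :
    ∃ b, t < b ∧ ∀ s ∈ Icc t b, P s := by
  obtain ⟨b, hb, hsub⟩ := mem_nhdsGE_iff_exists_Icc_subset.1 h
  exact ⟨b, hb, hsub⟩

theorem SolvesODE.eqOn {V : ℝ → E n → E n} {T : EReal} {x y : ℝ → E n}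
    (hx : SolvesODE V T x) (hy : SolvesODE V T y) (h0 : x 0 = y 0)
    (hV : ∀ t ∈ timeInterval T, ∃ K : ℝ≥0, ∃ s ∈ 𝓝 (x t),
      ∀ᶠ r in 𝓝[≥] t, LipschitzOnWith K (V r) s) :
    EqOn x y (timeInterval T) := by
  refine timeInterval_induction h0 (fun b hb => ?_) (fun t ht hxy => ?_)
  · have := (hx.continuousOn_Icc le_rfl hb).prodMk (hy.continuousOn_Icc le_rfl hb)
    have := this.preimage_isClosed_of_isClosed isClosed_Icc (isClosed_diagonal (X := E n))
    rwa [inter_comm] at this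
  · obtain ⟨K, s, hs, hK⟩ := hV t ht
    have hxs : ∀ᶠ r in 𝓝[≥] t, x r ∈ s :=
      (hx.continuousWithinAt ht).mono (Ici_subset_Ici.2 ht.1) hs
    have hys : ∀ᶠ r in 𝓝[≥] t, y r ∈ s :=
      (hy.continuousWithinAt ht).mono (Ici_subset_Ici.2 ht.1) (hxy ▸ hs)
    obtain ⟨b, hb, H⟩ := exists_Icc_of_eventually
      (hK.and (hxs.and (hys.and (eventually_mem_timeInterval ht))))
    have hbT := (H b ⟨hb.le, le_rfl⟩).2.2.2
    have hsub : ∀ r ∈ Ico t b, r ∈ Icc t b := fun r hr => ⟨hr.1, hr.2.le⟩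
    have := ODE_solution_unique_of_mem_Icc_right (v := V) (s := fun _ => s) (K := K)
      (fun r hr => (H r (hsub r hr)).1)
      (hx.continuousOn_Icc ht.1 hbT)
      (fun r hr => hx.hasDerivWithinAt_Ici (H r (hsub r hr)).2.2.2)
      (fun r hr => (H r (hsub r hr)).2.1)
      (hy.continuousOn_Icc ht.1 hbT)
      (fun r hr => hy.hasDerivWithinAt_Ici (H r (hsub r hr)).2.2.2)
      (fun r hr => (H r (hsub r hr)).2.2.1) hxy
    filter_upwards [Icc_mem_nhdsGE hb] with r hr using this hr

/-- A solution that stays in `A` and can only end by escaping to infinity is the trajectory, as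
soon as the equation has local uniqueness along it: a solution defined beyond a finite end time
would be bounded near it. -/
theorem RemainsIn.isTrajectory {V : ℝ → E n → E n} {T : EReal} {x : ℝ → E n} {A : Set (E n)}
    (hT : 0 < T) (hx : SolvesODE V T x) (hA : RemainsIn A T x)
    (hV : ∀ t ∈ timeInterval T, ∃ K : ℝ≥0, ∃ s ∈ 𝓝 (x t),
      ∀ᶠ r in 𝓝[≥] t, LipschitzOnWith K (V r) s) :
    IsTrajectory V (x 0) T x := by
  refine ⟨hT, rfl, hx, fun T' y hy0 hy => ?_⟩
  have hle : T' ≤ T := by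
    by_contra! hlt
    have heq := hx.eqOn (hy.mono hlt.le) hy0.symm hV
    lift T to ℝ using ⟨hlt.ne_top, (EReal.bot_lt_zero.trans hT).ne'⟩ with τ
    have hτ : 0 < τ := EReal.coe_pos.1 hT
    have hcont : Tendsto y (𝓝[<] τ) (𝓝 (y τ)) := by
      have h1 : ContinuousAt y τ :=
        (hy.continuousWithinAt ⟨hτ.le, hlt⟩).continuousAt (Ici_mem_nhds hτ)
      exact h1.tendsto.mono_left nhdsWithin_le_nhds
    refine not_tendsto_nhds_of_tendsto_atTop (hA.2 τ rfl) ‖y τ‖ (hcont.norm.congr' ?_)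
    filter_upwards [Ioo_mem_nhdsLT hτ] with t ht
    rw [heq ⟨ht.1.le, EReal.coe_lt_coe_iff.2 ht.2⟩]
  refine ⟨hle, fun t ht => (SolvesODE.eqOn (hx.mono hle) hy hy0.symm ?_ ht).symm⟩
  exact fun t ht => hV t ⟨ht.1, ht.2.trans_le hle⟩

/-- Follow a solution up to time `t`, and from there on another solution that starts where the
first one was left. -/
theorem SolvesODE.glue {V : ℝ → E n → E n} {T : EReal} {x z : ℝ → E n} {t ε : ℝ}
    (hx : SolvesODE V T x) (ht : t ∈ timeInterval T) (hε : 0 < ε) (hz0 : z t = x t)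
    (hz : ∀ s ∈ Ioo (t - ε) (t + ε), HasDerivAt z (V s (z s)) s) :
    SolvesODE V (t + ε : ℝ) (fun s => if s ≤ t then x s else z s) := by
  refine solvesODE_iff.2 fun s hs0 hs => ?_
  have hs' : s < t + ε := EReal.coe_lt_coe_iff.1 hs
  rcases lt_trichotomy s t with hst | rfl | hst
  · simp only [hst.le, if_true]
    refine (solvesODE_iff.1 hx s hs0 (mem_timeInterval_of_le ht hs0 hst.le).2).congr_of_eventuallyEq
      ?_ (by simp [hst.le])
    filter_upwards [nhdsWithin_le_nhds (Iio_mem_nhds hst)] with r hr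
    simp [(show r < t from hr).le]
  · simp only [le_refl, if_true]
    have h1 : HasDerivWithinAt (fun r => if r ≤ s then x r else z r) (V s (x s)) (Icc 0 s) s :=
      ((solvesODE_iff.1 hx s hs0 ht.2).mono Icc_subset_Ici_self).congr
        (fun r hr => by simp [hr.2]) (by simp)
    have h2 : HasDerivWithinAt (fun r => if r ≤ s then x r else z r) (V s (x s)) (Ici s) s := by
      have := (hz s ⟨by linarith, hs'⟩).hasDerivWithinAt (s := Ici s)
      rw [hz0] at this
      refine this.congr (fun r hr => ?_) (by simp [hz0])
      rcases eq_or_lt_of_le (show s ≤ r from hr) with rfl | h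
      · simp [hz0]
      · simp [h.not_ge]
    rw [← Icc_union_Ici_eq_Ici hs0]
    exact h1.union h2
  · simp only [hst.not_ge, if_false]
    refine (hz s ⟨by linarith, hs'⟩).hasDerivWithinAt.congr_of_eventuallyEq ?_ (by simp [hst.not_ge])
    filter_upwards [nhdsWithin_le_nhds (Ioi_mem_nhds hst)] with r hr
    simp [(show t < r from hr).not_ge]

/-! ### Existence of solutions up to escape -/

/-- The Picard–Lindelöf theorem for an autonomous field that is Lipschitz near `p`: the time of
existence is the same for all initial values near `p`. -/
theorem LipschitzNear.exists_hasDerivAt {F : E n → E n} {p : E n} (hF : LipschitzNear F p) :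
    ∃ r > (0 : ℝ), ∃ ε > (0 : ℝ), ∀ q ∈ Metric.ball p r, ∀ t₀ : ℝ, ∃ z : ℝ → E n, z t₀ = q ∧
      ∀ t ∈ Ioo (t₀ - ε) (t₀ + ε), HasDerivAt z (F (z t)) t := by
  obtain ⟨K, s, hs, hl⟩ := hF
  obtain ⟨a, ha : 0 < a, has⟩ := Metric.nhds_basis_closedBall.mem_iff.1 hs
  set L : ℝ := K * a + ‖F p‖ + 1 with hL
  have hL0 : 0 < L := by positivity
  have hb : ∀ x ∈ Metric.closedBall p a, ‖F x‖ ≤ L := fun x hx => by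
    calc ‖F x‖ ≤ ‖F x - F p‖ + ‖F p‖ := norm_le_norm_sub_add _ _
      _ ≤ K * ‖x - p‖ + ‖F p‖ := by
        gcongr
        exact hl.norm_sub_le (has hx) (mem_of_mem_nhds hs)
      _ ≤ K * a + ‖F p‖ := by
        gcongr
        rwa [← mem_closedBall_iff_norm]
      _ ≤ L := le_add_of_nonneg_right zero_le_one
  have hε0 : 0 < a / L / 2 := by positivity
  refine ⟨a / 2, half_pos ha, a / L / 2, hε0, fun q hq t₀ => ?_⟩
  have hpl : IsPicardLindelof (fun _ => F) (tmin := t₀ - a / L / 2) (tmax := t₀ + a / L / 2)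
      ⟨t₀, by simp [hε0.le]⟩ p ⟨a, ha.le⟩ ⟨a / 2, (half_pos ha).le⟩ ⟨L, hL0.le⟩ K := by
    refine IsPicardLindelof.of_time_independent hb (hl.mono has) ?_
    simp only [add_sub_cancel_left, sub_sub_cancel, max_self]
    change L * (a / L / 2) ≤ a - a / 2
    apply le_of_eq
    field_simp
    norm_num
  obtain ⟨z, hz0, hz⟩ := hpl.exists_eq_forall_mem_Icc_hasDerivWithinAt
    (Metric.ball_subset_closedBall hq)
  exact ⟨z, hz0, fun t ht => (hz t (Ioo_subset_Icc_self ht)).hasDerivAt (Icc_mem_nhds ht.1 ht.2)⟩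

/-- If solutions that start in the closed set `A` cannot leave it, and the field is Lipschitz near
the points of `A`, then from every point of `A` there is a solution that is contained in `A` for
all time. The solution is the union of all solutions from the given point; if it ended at a finite
time without escaping to infinity, it would accumulate at a point of `A` and could be continued
from a point nearby. -/
theorem exists_solvesODE_remainsIn {F : E n → E n} {A : Set (E n)} (hA : IsClosed A)
    (hF : ∀ a ∈ A, LipschitzNear F a)
    (hinv : ∀ (T : EReal) (y : ℝ → E n), SolvesODE (fun _ => F) T y → y 0 ∈ A →
      ∀ t ∈ timeInterval T, y t ∈ A)
    {x₀ : E n} (hx₀ : x₀ ∈ A) :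
    ∃ (T : EReal) (x : ℝ → E n), 0 < T ∧ x 0 = x₀ ∧ SolvesODE (fun _ => F) T x ∧
      RemainsIn A T x := by
  set 𝒯 : Set EReal := {T | 0 < T ∧ ∃ y : ℝ → E n, y 0 = x₀ ∧ SolvesODE (fun _ => F) T y}
  obtain ⟨T₀, hT₀⟩ : 𝒯.Nonempty := by
    obtain ⟨r, hr, ε, hε, H⟩ := (hF x₀ hx₀).exists_hasDerivAt
    obtain ⟨z, hz0, hz⟩ := H x₀ (Metric.mem_ball_self hr) 0
    refine ⟨(ε : EReal), EReal.coe_pos.2 hε, z, hz0, solvesODE_iff.2 fun t h0 ht => ?_⟩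
    refine (hz t ⟨by linarith, ?_⟩).hasDerivWithinAt
    simpa using EReal.coe_lt_coe_iff.1 ht
  have hpos : 0 < sSup 𝒯 := hT₀.1.trans_le (le_sSup hT₀)
  have hex : ∀ t : ℝ, ∃ (T : EReal) (y : ℝ → E n), (t : EReal) < sSup 𝒯 →
      (t : EReal) < T ∧ y 0 = x₀ ∧ SolvesODE (fun _ => F) T y := by
    intro t
    by_cases ht : (t : EReal) < sSup 𝒯
    · obtain ⟨T, ⟨-, y, hy⟩, htT⟩ := lt_sSup_iff.1 ht
      exact ⟨T, y, fun _ => ⟨htT, hy⟩⟩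
    · exact ⟨0, 0, fun h => absurd h ht⟩
  choose τ Y hY using hex
  have huniq : ∀ (T : EReal) (y y' : ℝ → E n), y 0 = x₀ → y' 0 = x₀ →
      SolvesODE (fun _ => F) T y → SolvesODE (fun _ => F) T y' → EqOn y y' (timeInterval T) := by
    intro T y y' h0 h0' hy hy'
    refine hy.eqOn hy' (h0.trans h0'.symm) fun t ht => ?_
    obtain ⟨K, s, hs, hK⟩ := hF _ (hinv T y hy (h0 ▸ hx₀) t ht)
    exact ⟨K, s, hs, Eventually.of_forall fun _ => hK⟩
  -- The chosen solutions agree where they overlap, so that evaluating at time `s` the solution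
  -- chosen for `s` defines one curve that solves the equation.
  have hxY : ∀ t : ℝ, (t : EReal) < sSup 𝒯 → ∀ s : ℝ, 0 ≤ s → (s : EReal) < τ t →
      (s : EReal) < sSup 𝒯 → Y s s = Y t s := by
    intro t ht s hs hst hsT
    obtain ⟨h1, h2, h3⟩ := hY t ht
    obtain ⟨h1', h2', h3'⟩ := hY s hsT
    exact huniq (min (τ t) (τ s)) _ _ h2' h2 (h3'.mono (min_le_right _ _))
      (h3.mono (min_le_left _ _)) ⟨hs, lt_min hst h1'⟩
  set x : ℝ → E n := fun t => Y t t
  have hx0 : x 0 = x₀ := (hY 0 hpos).2.1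
  have hsol : SolvesODE (fun _ => F) (sSup 𝒯) x := by
    refine solvesODE_iff.2 fun t h0 ht => ?_
    obtain ⟨h1, h2, h3⟩ := hY t ht
    refine (solvesODE_iff.1 h3 t h0 h1).congr_of_eventuallyEq ?_ rfl
    have hev : ∀ {T : EReal}, (t : EReal) < T → ∀ᶠ s : ℝ in 𝓝[Ici 0] t, (s : EReal) < T :=
      fun h => Filter.Eventually.filter_mono nhdsWithin_le_nhds
        ((isOpen_lt continuous_coe_real_ereal continuous_const).mem_nhds h)
    filter_upwards [hev h1, hev ht, self_mem_nhdsWithin] with s hs hsT hs0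
    exact hxY t ht s hs0 hs hsT
  have hmem : ∀ t ∈ timeInterval (sSup 𝒯), x t ∈ A := hinv _ x hsol (hx0.symm ▸ hx₀)
  refine ⟨sSup 𝒯, x, hpos, hx0, hsol, hmem, fun τ hτ => ?_⟩
  -- Otherwise the curve returns to a bounded part of `A` at times arbitrarily close to `τ`.
  by_contra hnot
  have hτ0 : 0 < τ := EReal.coe_pos.1 (hτ ▸ hpos)
  obtain ⟨M, hM⟩ : ∃ M : ℝ, ∃ᶠ t in 𝓝[<] τ, ‖x t‖ < M := by
    rw [tendsto_atTop] at hnot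
    push Not at hnot
    obtain ⟨M, hM⟩ := hnot
    exact ⟨M, hM⟩
  have hM' : ∃ᶠ t in 𝓝[<] τ, x t ∈ A ∩ Metric.closedBall 0 M := by
    refine (hM.and_eventually (Ioo_mem_nhdsLT hτ0)).mono fun t ht => ⟨hmem t ⟨ht.2.1.le, ?_⟩, ?_⟩
    · rw [hτ]; exact EReal.coe_lt_coe_iff.2 ht.2.2
    · simpa using ht.1.le
  obtain ⟨p, hp, hcl⟩ :=
    ((isCompact_closedBall (0 : E n) M).inter_left hA).exists_mapClusterPt_of_frequently hM'
  obtain ⟨r, hr, ε, hε, H⟩ := (hF p hp.1).exists_hasDerivAt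
  have hfreq : ∃ᶠ t in 𝓝[<] τ, x t ∈ Metric.ball p r := hcl.frequently (Metric.ball_mem_nhds p hr)
  obtain ⟨t, htb, ht1, ht2⟩ :=
    (hfreq.and_eventually (Ioo_mem_nhdsLT (max_lt hτ0 (sub_lt_self τ hε)))).exists
  obtain ⟨z, hz0, hz⟩ := H (x t) htb t
  have ht0 : 0 ≤ t := (le_max_left _ _).trans ht1.le
  -- The time `ε` of existence near `p` does not depend on `t`, and `t > τ - ε`.
  have hglue := hsol.glue ⟨ht0, hτ ▸ EReal.coe_lt_coe_iff.2 ht2⟩ hε hz0 hz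
  have hmem𝒯 : ((t + ε : ℝ) : EReal) ∈ 𝒯 :=
    ⟨EReal.coe_pos.2 (by linarith), _, by simp [ht0, hx0], hglue⟩
  have := le_sSup hmem𝒯
  rw [hτ, EReal.coe_le_coe_iff] at this
  linarith [(le_max_right 0 (τ - ε)).trans_lt ht1]

/-! ### Invariance of the safe region -/

/-- A function that starts nonnegative and does not decrease where it is negative stays
nonnegative. -/
theorem nonneg_of_deriv_right_nonneg_of_neg {φ φ' : ℝ → ℝ} {a b : ℝ}
    (hφ : ContinuousOn φ (Icc a b)) (hφ' : ∀ t ∈ Ico a b, HasDerivWithinAt φ (φ' t) (Ici t) t)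
    (ha : 0 ≤ φ a) (hneg : ∀ t ∈ Ico a b, φ t < 0 → 0 ≤ φ' t) :
    ∀ t ∈ Icc a b, 0 ≤ φ t := by
  intro t ht
  -- `-φ` cannot cross the barrier `ε (1 + s - a)`, whose slope is positive.
  have key : ∀ ε > (0 : ℝ), -φ t ≤ ε * (1 + (t - a)) := by
    intro ε hε
    have hB : ∀ s : ℝ, HasDerivAt (fun s => ε * (1 + (s - a))) ε s := fun s => by
      simpa using (((hasDerivAt_id s).sub_const a).const_add 1).const_mul ε
    refine image_le_of_deriv_right_lt_deriv_boundary' (f := fun s => -φ s) (f' := fun s => -φ' s)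
      (B := fun s => ε * (1 + (s - a))) (B' := fun _ => ε) hφ.neg (fun s hs => (hφ' s hs).neg)
      (by simp; linarith) (by fun_prop) (fun s _ => (hB s).hasDerivWithinAt) ?_ ht
    intro s hs heq
    have hs' : 0 < ε * (1 + (s - a)) := mul_pos hε (by linarith [hs.1])
    have heq' : -φ s = ε * (1 + (s - a)) := heq
    have := hneg s hs (by linarith)
    linarith
  have hpos : 0 < 1 + (t - a) := by linarith [ht.1]
  have : -φ t ≤ 0 := by
    refine le_of_forall_pos_le_add fun δ hδ => ?_
    have := key (δ / (1 + (t - a))) (div_pos hδ hpos)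
    rwa [div_mul_cancel₀ _ hpos.ne', ← zero_add δ] at this
  linarith

theorem fderiv_closedLoop {f : E n → E n} {g : E n → E m →L[ℝ] E n} {k : E n → E m}
    {φ : E n → ℝ} (z : E n) :
    fderiv ℝ φ z (closedLoop f g k z) = lieDeriv f φ z + lieDerivInput g φ z (k z) := by
  simp [closedLoop, lieDeriv, lieDerivInput]

theorem SolvesODE.nonneg_comp_of_deriv_nonneg {F : E n → E n} {φ : E n → ℝ}
    (hφ : ContDiff ℝ 1 φ) {T : EReal} {y : ℝ → E n} (hy : SolvesODE (fun _ => F) T y)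
    {a b : ℝ} (ha : 0 ≤ a) (hb : b ∈ timeInterval T) (h0 : 0 ≤ φ (y a))
    (hneg : ∀ t ∈ Icc a b, φ (y t) < 0 → 0 ≤ fderiv ℝ φ (y t) (F (y t))) :
    ∀ t ∈ Icc a b, 0 ≤ φ (y t) := by
  refine nonneg_of_deriv_right_nonneg_of_neg (φ' := fun t => fderiv ℝ φ (y t) (F (y t)))
    (hφ.continuous.comp_continuousOn (hy.continuousOn_Icc ha hb)) (fun t ht => ?_) h0
    (fun t ht => hneg t (Ico_subset_Icc_self ht))
  have ht' : t ∈ timeInterval T := mem_timeInterval_of_le hb (ha.trans ht.1) ht.2.le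
  exact ((hφ.differentiable one_ne_zero).differentiableAt.hasFDerivAt).comp_hasDerivWithinAt t
    (hy.hasDerivWithinAt_Ici ht')

theorem isClosed_safeRegion {f : E n → E n} {ψ : E n → ℝ} {α₁ : ℝ → ℝ} (hψ : Continuous ψ)
    (hh : Continuous (hocbf f ψ α₁)) : IsClosed (safeRegion f ψ α₁) :=
  (isClosed_le continuous_const hψ).inter (isClosed_le continuous_const hh)

/-- The safe region cannot be left if, near each of its points, `h` does not decrease along the
closed loop wherever it is negative. While `h ≥ 0`, the function `ψ` does not decrease where it is
negative either, because its derivative is `h - α₁(ψ)`: the input does not enter. -/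
theorem SolvesODE.mem_safeRegion {f : E n → E n} {g : E n → E m →L[ℝ] E n} {k : E n → E m}
    {ψ : E n → ℝ} {α₁ : ℝ → ℝ} (hψ : ContDiff ℝ 1 ψ) (hh : ContDiff ℝ 1 (hocbf f ψ α₁))
    (hα₁ : IsExtClassK α₁) (hLg : ∀ x, lieDerivInput g ψ x = 0)
    (hk : ∀ a ∈ safeRegion f ψ α₁, ∀ᶠ z in 𝓝 a, hocbf f ψ α₁ z < 0 →
      0 ≤ fderiv ℝ (hocbf f ψ α₁) z (closedLoop f g k z))
    {T : EReal} {y : ℝ → E n} (hy : SolvesODE (fun _ => closedLoop f g k) T y)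
    (h0 : y 0 ∈ safeRegion f ψ α₁) :
    ∀ t ∈ timeInterval T, y t ∈ safeRegion f ψ α₁ := by
  refine timeInterval_induction h0 (fun b hb => ?_) (fun t ht hyt => ?_)
  · have := (hy.continuousOn_Icc le_rfl hb).preimage_isClosed_of_isClosed isClosed_Icc
      (isClosed_safeRegion hψ.continuous hh.continuous)
    rwa [inter_comm] at this
  · have hev := ((hy.continuousWithinAt ht).mono (Ici_subset_Ici.2 ht.1)).eventually (hk _ hyt)
    obtain ⟨b, hb, H⟩ := exists_Icc_of_eventually (hev.and (eventually_mem_timeInterval ht))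
    have hbT := (H b ⟨hb.le, le_rfl⟩).2
    have hh0 := hy.nonneg_comp_of_deriv_nonneg hh ht.1 hbT hyt.2 fun s hs => (H s hs).1
    -- `L_g ψ = 0` removes the input from the derivative of `ψ`.
    have hψ0 := hy.nonneg_comp_of_deriv_nonneg hψ ht.1 hbT hyt.1 fun s hs hneg => by
      have h1 : 0 ≤ lieDeriv f ψ (y s) + α₁ (ψ (y s)) := hh0 s hs
      have h2 : α₁ (ψ (y s)) < 0 := hα₁.2.2 ▸ hα₁.2.1 hneg
      rw [fderiv_closedLoop, hLg]
      simp only [zero_apply, add_zero]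
      linarith
    filter_upwards [Icc_mem_nhdsGE hb] with s hs using ⟨hψ0 s hs, hh0 s hs⟩

/-! ### Control invariance through a smooth feedback -/

/-- Where `h` vanishes, decay does not help, and some input makes `h` increase. -/
theorem ODCondition.exists_input {f : E n → E n} {g : E n → E m →L[ℝ] E n} {h : E n → ℝ}
    {α : ℝ → ℝ} {x : E n} (hx : ODCondition f g h α x) (hα : α 0 = 0) (h0 : h x = 0) :
    ∃ u : E m, 0 < lieDeriv f h x + lieDerivInput g h x u := by
  obtain ⟨u, hu⟩ := lt_iSup_iff.1 hx
  obtain ⟨ω, hω⟩ := lt_iSup_iff.1 hu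
  refine ⟨u, ?_⟩
  rw [h0, hα, mul_zero, add_zero] at hω
  exact EReal.coe_pos.1 hω

theorem continuous_lieDeriv {f : E n → E n} {φ : E n → ℝ} (hf : Continuous f)
    (hφ : ContDiff ℝ 1 φ) : Continuous (lieDeriv f φ) :=
  (hφ.continuous_fderiv one_ne_zero).clm_apply hf

theorem continuous_lieDerivInput {g : E n → E m →L[ℝ] E n} {φ : E n → ℝ} (hg : Continuous g)
    (hφ : ContDiff ℝ 1 φ) : Continuous (lieDerivInput g φ) :=
  (hφ.continuous_fderiv one_ne_zero).clm_comp hg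

/-- A smooth feedback, patched together by a partition of unity, under which `h` strictly
increases at the points of a closed set at which it vanishes. -/
theorem exists_smooth_feedback {f : E n → E n} {g : E n → E m →L[ℝ] E n} {h : E n → ℝ}
    (hf : Continuous f) (hg : Continuous g) (hh : ContDiff ℝ 1 h) {A : Set (E n)}
    (hA : IsClosed A)
    (hex : ∀ x ∈ A, h x = 0 → ∃ u : E m, 0 < lieDeriv f h x + lieDerivInput g h x u) :
    ∃ k : E n → E m, ContDiff ℝ 1 k ∧
      ∀ x ∈ A, h x = 0 → 0 < lieDeriv f h x + lieDerivInput g h x (k x) := by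
  have hZ : IsClosed (A ∩ {x | h x = 0}) :=
    hA.inter (isClosed_eq hh.continuous continuous_const)
  -- Off `A ∩ {h = 0}` every input is admitted; as this set is closed, a constant input that is
  -- admissible at a point is admissible near it.
  set t : E n → Set (E m) := fun x => {u | x ∈ A ∩ {x | h x = 0} →
    0 < lieDeriv f h x + lieDerivInput g h x u} with ht
  have hconv : ∀ x, Convex ℝ (t x) := by
    intro x
    by_cases hx : x ∈ A ∩ {x | h x = 0}
    · have : t x = {u | -lieDeriv f h x < (lieDerivInput g h x).toLinearMap u} := by
        ext u
        simp only [ht, mem_ofPred_eq, hx, forall_const, ContinuousLinearMap.coe_coe]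
        constructor <;> intro <;> linarith
      rw [this]
      exact convex_halfSpace_gt (LinearMap.isLinear _) _
    · have : t x = univ := eq_univ_of_forall fun u hx' => absurd hx' hx
      rw [this]
      exact convex_univ
  have hloc : ∀ x, ∃ u : E m, ∀ᶠ y in 𝓝 x, u ∈ t y := by
    intro x
    by_cases hx : x ∈ A ∩ {x | h x = 0}
    · obtain ⟨u, hu⟩ := hex x hx.1 hx.2
      have hc : Continuous fun y => lieDeriv f h y + lieDerivInput g h y u :=
        (continuous_lieDeriv hf hh).add
          ((continuous_lieDerivInput hg hh).clm_apply continuous_const)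
      exact ⟨u, (hc.continuousAt.eventually (lt_mem_nhds hu)).mono fun y hy _ => hy⟩
    · refine ⟨0, ?_⟩
      filter_upwards [hZ.isOpen_compl.mem_nhds hx] with y hy hy' using absurd hy' hy
  obtain ⟨k, hk⟩ := exists_contMDiffMap_forall_mem_convex_of_local_const (n := 1)
    (modelWithCornersSelf ℝ (E n)) hconv hloc
  exact ⟨k, k.contMDiff.contDiff, fun x hx h0 => hk x ⟨hx, h0⟩⟩

theorem LipschitzNear.closedLoop {f : E n → E n} {g : E n → E m →L[ℝ] E n} {k : E n → E m}
    {x : E n} (hf : LipschitzNear f x) (hg : LipschitzNear g x) (hk : LipschitzNear k x) :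
    LipschitzNear (closedLoop f g k) x :=
  hf.add (hg.clm_apply hk)

/-- Under an input that is continuous in time, the controlled equation is Lipschitz in the state,
locally uniformly in time. -/
theorem exists_lipschitzOnWith_of_continuousWithinAt {f : E n → E n} {g : E n → E m →L[ℝ] E n}
    {u : ℝ → E m} {p : E n} {t : ℝ} (hf : LipschitzNear f p) (hg : LipschitzNear g p)
    (hu : ContinuousWithinAt u (Ici t) t) :
    ∃ K : ℝ≥0, ∃ s ∈ 𝓝 p, ∀ᶠ r in 𝓝[≥] t, LipschitzOnWith K (fun z => f z + g z (u r)) s := by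
  obtain ⟨K₁, s₁, hs₁, h₁⟩ := hf
  obtain ⟨K₂, s₂, hs₂, h₂⟩ := hg
  refine ⟨K₁ + K₂ * (‖u t‖₊ + 1), s₁ ∩ s₂, inter_mem hs₁ hs₂, ?_⟩
  filter_upwards [hu.nnnorm.eventually (gt_mem_nhds (lt_add_one ‖u t‖₊))] with r hr
  refine (h₁.mono inter_subset_left).add (LipschitzOnWith.of_dist_le_mul fun x hx y hy => ?_)
  rw [dist_eq_norm, ← sub_apply]
  calc ‖(g x - g y) (u r)‖ ≤ ‖g x - g y‖ * ‖u r‖ := (g x - g y).le_opNorm _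
    _ ≤ (K₂ * dist x y) * (‖u t‖ + 1) := by
      gcongr
      · rw [← dist_eq_norm]
        exact h₂.dist_le_mul x hx.2 y hy.2
      · exact_mod_cast hr.le
    _ = _ := by push_cast; ring

theorem contDiff_hocbf {f : E n → E n} {ψ : E n → ℝ} {α₁ : ℝ → ℝ} (hψ : ContDiff ℝ 1 ψ)
    (hLψ : ContDiff ℝ 1 (lieDeriv f ψ)) (hα₁ : ContDiff ℝ 1 α₁) :
    ContDiff ℝ 1 (hocbf f ψ α₁) :=
  hLψ.add (hα₁.comp hψ)

theorem isControlInvariant_safeRegion {f : E n → E n} {g : E n → E m →L[ℝ] E n}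
    (hf : LocallyLipschitz f) (hg : LocallyLipschitz g)
    {ψ : E n → ℝ} (hψ : ContDiff ℝ 1 ψ) (hLψ : ContDiff ℝ 1 (lieDeriv f ψ))
    {α₁ : ℝ → ℝ} (hα₁ : ContDiff ℝ 1 α₁) (hOD : IsODHOCBF f g ψ α₁) :
    IsControlInvariant f g (safeRegion f ψ α₁) := by
  intro x₀ hx₀
  obtain ⟨hrel, hα₁K, α, hα, hcond⟩ := hOD
  have hh := contDiff_hocbf hψ hLψ hα₁
  have hA := isClosed_safeRegion hψ.continuous hh.continuous
  obtain ⟨k, hkC, hk⟩ := exists_smooth_feedback hf.continuous hg.continuous hh hA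
    fun x hx h0 => (hcond x hx).exists_input hα.2.2 h0
  have hev : ∀ a ∈ safeRegion f ψ α₁, ∀ᶠ z in 𝓝 a, hocbf f ψ α₁ z < 0 →
      0 ≤ fderiv ℝ (hocbf f ψ α₁) z (closedLoop f g k z) := by
    intro a ha
    rcases (show 0 ≤ hocbf f ψ α₁ a from ha.2).eq_or_lt with h0 | hpos
    · have hc : Continuous fun y => lieDeriv f (hocbf f ψ α₁) y
          + lieDerivInput g (hocbf f ψ α₁) y (k y) :=
        (continuous_lieDeriv hf.continuous hh).add
          ((continuous_lieDerivInput hg.continuous hh).clm_apply hkC.continuous)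
      filter_upwards [hc.continuousAt.eventually (lt_mem_nhds (hk a ha h0.symm))] with z hz _
      rw [fderiv_closedLoop]
      exact hz.le
    · filter_upwards [hh.continuous.continuousAt.eventually (lt_mem_nhds hpos)] with z hz hz'
      exact absurd hz hz'.not_gt
  obtain ⟨T, x, hT, hx0, hx, hrem⟩ := exists_solvesODE_remainsIn hA
    (fun a _ => LipschitzNear.closedLoop (hf a) (hg a) hkC.contDiffAt.lipschitzNear)
    (fun T y hy h0 => hy.mem_safeRegion hψ hh hα₁K (hrel.2.1 0 le_rfl) hev h0) hx₀
  have hu : ∀ t ∈ timeInterval T, ContinuousWithinAt (fun t => k (x t)) (Ici 0) t := fun t ht =>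
    hkC.continuous.continuousAt.comp_continuousWithinAt (hx.continuousWithinAt ht)
  refine ⟨T, fun t => k (x t), x, fun t ht => (hu t ht).mono fun _ hs => hs.1, ?_, hrem⟩
  rw [← hx0]
  refine RemainsIn.isTrajectory hT hx hrem fun t ht => ?_
  exact exists_lipschitzOnWith_of_continuousWithinAt (hf _) (hg _)
    ((hu t ht).mono (Ici_subset_Ici.2 ht.1))

/-! ### The explicit solution of the quadratic program -/

/-- The vector that represents a linear form with respect to the inner product `vᵀ Γ w`, namely
`Γ⁻¹ bᵀ`. It is bundled as a continuous linear function of the form `b`. -/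
noncomputable def riesz (Γ : Matrix (Fin m) (Fin m) ℝ) : (E m →L[ℝ] ℝ) →L[ℝ] E m :=
  LinearMap.toContinuousLinearMap
    { toFun := fun b => WithLp.toLp 2 (Γ⁻¹ *ᵥ fun i => b (EuclideanSpace.single i 1))
      map_add' := fun b c => by
        rw [← WithLp.toLp_add, ← Matrix.mulVec_add]
        rfl
      map_smul' := fun r b => by
        rw [RingHom.id_apply, ← WithLp.toLp_smul, ← Matrix.mulVec_smul]
        rfl }

theorem dotProduct_mulVec_riesz {Γ : Matrix (Fin m) (Fin m) ℝ} (hΓ : Γ.PosDef)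
    (b : E m →L[ℝ] ℝ) (v : E m) : v.ofLp ⬝ᵥ (Γ *ᵥ (riesz Γ b).ofLp) = b v := by
  have h1 : (riesz Γ b).ofLp = Γ⁻¹ *ᵥ fun i => b (EuclideanSpace.single i 1) := rfl
  rw [h1, Matrix.mulVec_mulVec, Matrix.mul_nonsing_inv _ hΓ.det_pos.ne'.isUnit, Matrix.one_mulVec]
  have h2 : v = ∑ i, v i • EuclideanSpace.single i (1 : ℝ) := by
    ext j
    simp [Pi.single_apply]
  conv_rhs => rw [h2, map_sum]
  simp [dotProduct]

theorem dotProduct_mulVec_self_pos {Γ : Matrix (Fin m) (Fin m) ℝ} (hΓ : Γ.PosDef) {v : E m}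
    (hv : v ≠ 0) : 0 < v.ofLp ⬝ᵥ (Γ *ᵥ v.ofLp) := by
  have := hΓ.dotProduct_mulVec_pos (x := v.ofLp) (by simpa using hv)
  simpa using this

theorem dotProduct_mulVec_self_nonneg {Γ : Matrix (Fin m) (Fin m) ℝ} (hΓ : Γ.PosDef) (v : E m) :
    0 ≤ v.ofLp ⬝ᵥ (Γ *ᵥ v.ofLp) := by
  rcases eq_or_ne v 0 with rfl | hv
  · simp
  · exact (dotProduct_mulVec_self_pos hΓ hv).le

theorem apply_riesz_nonneg {Γ : Matrix (Fin m) (Fin m) ℝ} (hΓ : Γ.PosDef) (b : E m →L[ℝ] ℝ) :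
    0 ≤ b (riesz Γ b) := by
  rw [← dotProduct_mulVec_riesz hΓ]
  exact dotProduct_mulVec_self_nonneg hΓ _

theorem apply_riesz_pos {Γ : Matrix (Fin m) (Fin m) ℝ} (hΓ : Γ.PosDef) {b : E m →L[ℝ] ℝ}
    (hb : b ≠ 0) : 0 < b (riesz Γ b) := by
  have : riesz Γ b ≠ 0 := fun h0 => hb <| by
    ext v
    rw [← dotProduct_mulVec_riesz hΓ b v, h0]
    simp
  rw [← dotProduct_mulVec_riesz hΓ]
  exact dotProduct_mulVec_self_pos hΓ this

/-- Completing the square along the direction `riesz Γ b`. -/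
theorem dotProduct_mulVec_add_smul_riesz {Γ : Matrix (Fin m) (Fin m) ℝ} (hΓ : Γ.PosDef)
    (b : E m →L[ℝ] ℝ) (r : ℝ) (d : E m) :
    (d + r • riesz Γ b).ofLp ⬝ᵥ (Γ *ᵥ (d + r • riesz Γ b).ofLp) =
      d.ofLp ⬝ᵥ (Γ *ᵥ d.ofLp) + 2 * r * b d + r ^ 2 * b (riesz Γ b) := by
  have hsymm : (riesz Γ b).ofLp ⬝ᵥ (Γ *ᵥ d.ofLp) = b d := by
    have hT : Γᵀ = Γ := by simpa using hΓ.isHermitian.eq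
    rw [Matrix.dotProduct_mulVec, ← Matrix.mulVec_transpose, hT, dotProduct_comm,
      dotProduct_mulVec_riesz hΓ]
  simp only [WithLp.ofLp_add, WithLp.ofLp_smul, Matrix.mulVec_add, Matrix.mulVec_smul,
    add_dotProduct, dotProduct_add, smul_dotProduct, dotProduct_smul, smul_eq_mul]
  rw [hsymm, dotProduct_mulVec_riesz hΓ, dotProduct_mulVec_riesz hΓ]
  ring

section QP

variable (f : E n → E n) (g : E n → E m →L[ℝ] E n) (h : E n → ℝ) (α : ℝ → ℝ)
  (kd : E n → E m) (Γ : Matrix (Fin m) (Fin m) ℝ) (p θd : ℝ)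

/-- The slack that the desired pair `(kd, θd)` leaves in the barrier constraint: the pair is
feasible if and only if it is nonnegative. -/
noncomputable def qpSlack (x : E n) : ℝ :=
  lieDeriv f h x + lieDerivInput g h x (kd x) + θd * α (h x)

/-- The squared norm, dual to that of the cost, of the gradient of the barrier constraint in
`(u, ω)`. Only the positive part of `α(h)` counts, since raising `ω` does not help where
`α(h) < 0`. -/
noncomputable def qpGain (x : E n) : ℝ :=
  lieDerivInput g h x (riesz Γ (lieDerivInput g h x)) + max 0 (α (h x)) ^ 2 / p

/-- The Lagrange multiplier of the barrier constraint. -/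
noncomputable def qpMultiplier (x : E n) : ℝ :=
  max 0 (-qpSlack f g h α kd θd x) / qpGain g h α Γ p x

/-- The input component of the minimizer. -/
noncomputable def qpInput (x : E n) : E m :=
  kd x + qpMultiplier f g h α kd Γ p θd x • riesz Γ (lieDerivInput g h x)

/-- The decay component of the minimizer. -/
noncomputable def qpDecay (x : E n) : ℝ :=
  θd + qpMultiplier f g h α kd Γ p θd x * max 0 (α (h x)) / p

variable {f g h α kd Γ p θd}

theorem qpGain_nonneg (hΓ : Γ.PosDef) (hp : 0 < p) (x : E n) : 0 ≤ qpGain g h α Γ p x :=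
  add_nonneg (apply_riesz_nonneg hΓ _) (by positivity)

theorem qpMultiplier_nonneg (hΓ : Γ.PosDef) (hp : 0 < p) (x : E n) :
    0 ≤ qpMultiplier f g h α kd Γ p θd x :=
  div_nonneg (le_max_left _ _) (qpGain_nonneg hΓ hp x)

/-- Where the gain vanishes, the multiplier is `0`, by the convention for division by `0`; this is
the right value when the slack is nonnegative. -/
theorem qpMultiplier_mul_qpGain {x : E n}
    (hx : 0 ≤ qpSlack f g h α kd θd x ∨ 0 < qpGain g h α Γ p x) :
    qpMultiplier f g h α kd Γ p θd x * qpGain g h α Γ p x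
      = max 0 (-qpSlack f g h α kd θd x) := by
  rcases hx with hx | hx
  · have : max 0 (-qpSlack f g h α kd θd x) = 0 := max_eq_left (by linarith)
    simp [qpMultiplier, this]
  · exact div_mul_cancel₀ _ hx.ne'

theorem qpSolution_mem_qpFeasible (hΓ : Γ.PosDef) (hp : 0 < p) (hθ : 0 ≤ θd) {x : E n}
    (hx : 0 ≤ qpSlack f g h α kd θd x ∨ 0 < qpGain g h α Γ p x) :
    (qpInput f g h α kd Γ p θd x, qpDecay f g h α kd Γ p θd x) ∈ qpFeasible f g h α θd x := by
  have hle : θd ≤ qpDecay f g h α kd Γ p θd x := by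
    have := div_nonneg (mul_nonneg (qpMultiplier_nonneg (f := f) (g := g) (h := h) (α := α)
      (kd := kd) (θd := θd) hΓ hp x) (le_max_left 0 (α (h x)))) hp.le
    simpa [qpDecay] using this
  refine ⟨?_, hθ.trans hle, hle⟩
  have h1 := qpMultiplier_mul_qpGain hx
  have h2 : max 0 (α (h x)) * α (h x) = max 0 (α (h x)) ^ 2 := by
    rcases le_total 0 (α (h x)) with h0 | h0
    · rw [max_eq_right h0, sq]
    · rw [max_eq_left h0]; ring
  have h3 := le_max_right 0 (-qpSlack f g h α kd θd x)
  rw [← h1] at h3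
  simp only [qpInput, qpDecay, map_add, map_smul, smul_eq_mul]
  generalize qpMultiplier f g h α kd Γ p θd x = r at *
  simp only [qpSlack, qpGain] at h3
  have h4 : r * max 0 (α (h x)) / p * α (h x) = r * (max 0 (α (h x)) ^ 2 / p) := by
    rw [← h2]; ring
  nlinarith [h3, h4]

/-- The cost of a feasible pair exceeds that of the explicit solution by at least the square of
its distance: the cross term is the multiplier times the difference of the two constraint values,
and it is nonnegative by complementary slackness. -/
theorem qpCost_add_le (hΓ : Γ.PosDef) (hp : 0 < p) {x : E n}
    (hx : 0 ≤ qpSlack f g h α kd θd x ∨ 0 < qpGain g h α Γ p x) {w : E m × ℝ}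
    (hw : w ∈ qpFeasible f g h α θd x) :
    qpCost kd Γ p θd x (qpInput f g h α kd Γ p θd x, qpDecay f g h α kd Γ p θd x)
      + (1 / 2) * ((w.1 - qpInput f g h α kd Γ p θd x).ofLp ⬝ᵥ
          (Γ *ᵥ (w.1 - qpInput f g h α kd Γ p θd x).ofLp))
      + (1 / 2) * (p * (w.2 - qpDecay f g h α kd Γ p θd x) ^ 2) ≤ qpCost kd Γ p θd x w := by
  have h1 := qpMultiplier_mul_qpGain hx
  have hr := qpMultiplier_nonneg (f := f) (g := g) (h := h) (α := α) (kd := kd) (θd := θd) hΓ hp x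
  -- Complementary slackness: the multiplier vanishes, or the constraint is active at the solution.
  have hcomp : qpMultiplier f g h α kd Γ p θd x * (qpSlack f g h α kd θd x
      + qpMultiplier f g h α kd Γ p θd x * qpGain g h α Γ p x) = 0 := by
    rw [h1]
    rcases le_total 0 (qpSlack f g h α kd θd x) with h0 | h0
    · have : max 0 (-qpSlack f g h α kd θd x) = 0 := max_eq_left (by linarith)
      simp [qpMultiplier, this]
    · rw [max_eq_right (by linarith)]; ring
  obtain ⟨hw1, -, hw2⟩ := hw
  set b := lieDerivInput g h x with hb
  set r := qpMultiplier f g h α kd Γ p θd x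
  have hin : qpInput f g h α kd Γ p θd x = kd x + r • riesz Γ b := rfl
  have hdec : qpDecay f g h α kd Γ p θd x = θd + r * max 0 (α (h x)) / p := rfl
  set d := w.1 - qpInput f g h α kd Γ p θd x with hd
  have e1 : w.1 - kd x = d + r • riesz Γ b := by rw [hd, hin]; abel
  have e2 : qpInput f g h α kd Γ p θd x - kd x = 0 + r • riesz Γ b := by rw [hin]; abel
  have e3 : b d = b w.1 - b (kd x) - r * b (riesz Γ b) := by
    rw [hd, hin]; simp only [map_sub, map_add, map_smul, smul_eq_mul]; ring
  simp only [qpCost]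
  rw [e1, e2, dotProduct_mulVec_add_smul_riesz hΓ, dotProduct_mulVec_add_smul_riesz hΓ, e3, hdec]
  have hc : α (h x) * (w.2 - θd) ≤ max 0 (α (h x)) * (w.2 - θd) :=
    mul_le_mul_of_nonneg_right (le_max_right _ _) (by linarith)
  have hfeas : 0 ≤ qpSlack f g h α kd θd x + (b w.1 - b (kd x))
      + max 0 (α (h x)) * (w.2 - θd) := by
    simp only [qpSlack]
    linarith
  have hprod := mul_nonneg hr hfeas
  simp only [qpGain, ← hb] at hcomp
  generalize max 0 (α (h x)) = c at *
  simp only [WithLp.ofLp_zero, zero_dotProduct, map_zero]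
  -- The same expansion for the decay variable.
  have hdiff : (1 / 2) * (p * (w.2 - θd) ^ 2) - (1 / 2) * (p * (θd + r * c / p - θd) ^ 2)
      - (1 / 2) * (p * (w.2 - (θd + r * c / p)) ^ 2) = r * c * (w.2 - θd) - r * r * (c ^ 2 / p) := by
    field_simp
    ring
  linarith

theorem isQPSolution_iff (hΓ : Γ.PosDef) (hp : 0 < p) (hθ : 0 ≤ θd) {x : E n}
    (hx : 0 ≤ qpSlack f g h α kd θd x ∨ 0 < qpGain g h α Γ p x) {w : E m × ℝ} :
    IsQPSolution f g h α kd Γ p θd x w ↔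
      w = (qpInput f g h α kd Γ p θd x, qpDecay f g h α kd Γ p θd x) := by
  have hmem := qpSolution_mem_qpFeasible (f := f) (g := g) (h := h) (α := α) (kd := kd) hΓ hp hθ hx
  constructor
  · rintro ⟨hw, hmin⟩
    have h1 := qpCost_add_le hΓ hp hx hw
    have h2 : qpCost kd Γ p θd x w ≤ _ := hmin hmem
    have h3 := dotProduct_mulVec_self_nonneg hΓ (w.1 - qpInput f g h α kd Γ p θd x)
    have h4 : 0 ≤ p * (w.2 - qpDecay f g h α kd Γ p θd x) ^ 2 := by positivity
    refine Prod.ext ?_ ?_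
    · by_contra hne
      have := dotProduct_mulVec_self_pos hΓ (sub_ne_zero.2 hne)
      linarith
    · have h5 : p * (w.2 - qpDecay f g h α kd Γ p θd x) ^ 2 = 0 := by linarith
      simpa [hp.ne', sub_eq_zero] using h5
  · rintro rfl
    refine ⟨hmem, fun w hw => ?_⟩
    have h1 := qpCost_add_le hΓ hp hx hw
    have h3 := dotProduct_mulVec_self_nonneg hΓ (w.1 - qpInput f g h α kd Γ p θd x)
    have h4 : 0 ≤ p * (w.2 - qpDecay f g h α kd Γ p θd x) ^ 2 := by positivity
    change qpCost kd Γ p θd x _ ≤ qpCost kd Γ p θd x w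
    linarith

/-- At a point at which the optimal-decay condition holds and `h ≥ 0`, the barrier constraint is
either inactive or has a nonzero gradient. -/
theorem qpSlack_pos_or_qpGain_pos (hΓ : Γ.PosDef) (hp : 0 < p) (hα : IsExtClassK α)
    {β : ℝ → ℝ} (hβ : β 0 = 0) {x : E n} (hx : ODCondition f g h β x) (h0 : 0 ≤ h x) :
    0 < qpSlack f g h α kd θd x ∨ 0 < qpGain g h α Γ p x := by
  rcases h0.eq_or_lt with h0 | hpos
  · by_cases hb : lieDerivInput g h x = 0
    · left
      obtain ⟨u, hu⟩ := hx.exists_input hβ h0.symm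
      simpa [qpSlack, hb, ← h0, hα.2.2] using hu
    · right
      exact add_pos_of_pos_of_nonneg (apply_riesz_pos hΓ hb) (by positivity)
  · right
    have hc : 0 < α (h x) := hα.2.2 ▸ hα.2.1 hpos
    refine add_pos_of_nonneg_of_pos (apply_riesz_nonneg hΓ _) ?_
    rw [max_eq_right hc.le]
    positivity

end QP

/-! ### Forward invariance under the quadratic program controller -/

section QP

variable {f : E n → E n} {g : E n → E m →L[ℝ] E n} {h : E n → ℝ} {α : ℝ → ℝ}
  {kd : E n → E m} {Γ : Matrix (Fin m) (Fin m) ℝ} {p θd : ℝ}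

theorem lipschitzNear_lieDerivInput (hg : LocallyLipschitz g)
    (hdh : LocallyLipschitz (fderiv ℝ h)) (x : E n) : LipschitzNear (lieDerivInput g h) x :=
  LipschitzNear.clm_comp (hdh x) (hg x)

theorem lipschitzNear_qpSlack (hf : LocallyLipschitz f) (hg : LocallyLipschitz g)
    (hh : ContDiff ℝ 1 h) (hdh : LocallyLipschitz (fderiv ℝ h)) (hα : LocallyLipschitz α)
    (hkd : LocallyLipschitz kd) (x : E n) : LipschitzNear (qpSlack f g h α kd θd) x :=
  ((LipschitzNear.clm_apply (hdh x) (hf x)).add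
    ((lipschitzNear_lieDerivInput hg hdh x).clm_apply (hkd x))).add
    ((lipschitzNear_const θd x).mul
      (LipschitzNear.comp (hα (h x)) hh.contDiffAt.lipschitzNear))

theorem lipschitzNear_qpGain (hg : LocallyLipschitz g)
    (hh : ContDiff ℝ 1 h) (hdh : LocallyLipschitz (fderiv ℝ h)) (hα : LocallyLipschitz α)
    (hp : p ≠ 0) (x : E n) : LipschitzNear (qpGain g h α Γ p) x := by
  have hb := lipschitzNear_lieDerivInput hg hdh x
  have hc := (LipschitzNear.comp (hα (h x)) (hh.contDiffAt (x := x)).lipschitzNear).max_zero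
  have hG := ((lipschitzNear_const (riesz Γ) x).clm_apply hb)
  refine (hb.clm_apply hG).add (LipschitzNear.div ?_ (lipschitzNear_const p x) hp)
  exact (hc.mul hc).congr (Eventually.of_forall fun y => (sq _).symm)

/-- The explicit solution is a Lipschitz function of the state near a point with positive gain, by
its formula, and near a point with positive slack, where the input is the desired one. -/
theorem lipschitzNear_qpInput (hf : LocallyLipschitz f) (hg : LocallyLipschitz g)
    (hh : ContDiff ℝ 1 h) (hdh : LocallyLipschitz (fderiv ℝ h)) (hα : LocallyLipschitz α)
    (hkd : LocallyLipschitz kd) (hp : p ≠ 0) {x : E n}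
    (hx : 0 < qpSlack f g h α kd θd x ∨ 0 < qpGain g h α Γ p x) :
    LipschitzNear (qpInput f g h α kd Γ p θd) x := by
  have hS := lipschitzNear_qpSlack (θd := θd) hf hg hh hdh hα hkd x
  rcases hx with hx | hx
  · refine LipschitzNear.congr (hkd x) ?_
    filter_upwards [hS.continuousAt.eventually (lt_mem_nhds hx)] with y hy
    have : max 0 (-qpSlack f g h α kd θd y) = 0 := max_eq_left (by linarith)
    simp [qpInput, qpMultiplier, this]
  · have hneg : LipschitzNear (fun y => -qpSlack f g h α kd θd y) x :=
      LipschitzNear.comp (φ := fun r : ℝ => -r) contDiff_neg.contDiffAt.lipschitzNear hS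
    refine LipschitzNear.add (hkd x) (LipschitzNear.smul ?_ ?_)
    · exact hneg.max_zero.div (lipschitzNear_qpGain hg hh hdh hα hp x) hx.ne'
    · exact (lipschitzNear_const (riesz Γ) x).clm_apply (lipschitzNear_lieDerivInput hg hdh x)

theorem isForwardInvariant_safeRegion_of_isQPController
    (hf : LocallyLipschitz f) (hg : LocallyLipschitz g)
    {ψ : E n → ℝ} (hψ : ContDiff ℝ 1 ψ) {α₁ : ℝ → ℝ} (hh : ContDiff ℝ 1 (hocbf f ψ α₁))
    (hOD : IsODHOCBF f g ψ α₁) (hΓ : Γ.PosDef) (hp : 0 < p) (hθ : 0 ≤ θd)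
    (hkd : LocallyLipschitz kd) (hαK : IsExtClassK α) (hα : LocallyLipschitz α)
    (hdh : LocallyLipschitz (fderiv ℝ (hocbf f ψ α₁)))
    {k : E n → E m} {θ : E n → ℝ}
    (hk : IsQPController f g (hocbf f ψ α₁) α kd Γ p θd k θ) :
    IsForwardInvariant (closedLoop f g k) (safeRegion f ψ α₁) := by
  intro x₀ hx₀
  obtain ⟨hrel, hα₁K, β, hβ, hcond⟩ := hOD
  set h := hocbf f ψ α₁
  have hpos : ∀ a ∈ safeRegion f ψ α₁,
      0 < qpSlack f g h α kd θd a ∨ 0 < qpGain g h α Γ p a := fun a ha =>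
    qpSlack_pos_or_qpGain_pos hΓ hp hαK hβ.2.2 (hcond a ha) ha.2
  have hev : ∀ a ∈ safeRegion f ψ α₁, ∀ᶠ z in 𝓝 a,
      0 ≤ qpSlack f g h α kd θd z ∨ 0 < qpGain g h α Γ p z := by
    intro a ha
    rcases hpos a ha with h1 | h1
    · exact ((lipschitzNear_qpSlack hf hg hh hdh hα hkd a).continuousAt.eventually
        (lt_mem_nhds h1)).mono fun z hz => Or.inl hz.le
    · exact ((lipschitzNear_qpGain hg hh hdh hα hp.ne' a).continuousAt.eventually
        (lt_mem_nhds h1)).mono fun z hz => Or.inr hz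
  have hsol : ∀ z, (0 ≤ qpSlack f g h α kd θd z ∨ 0 < qpGain g h α Γ p z) →
      IsQPSolution f g h α kd Γ p θd z (k z, θ z) := fun z hz =>
    hk z ⟨_, qpSolution_mem_qpFeasible hΓ hp hθ hz⟩
  have hlip : ∀ a ∈ safeRegion f ψ α₁, LipschitzNear (closedLoop f g k) a := by
    intro a ha
    refine LipschitzNear.closedLoop (hf a) (hg a) ((lipschitzNear_qpInput hf hg hh hdh hα hkd
      hp.ne' (hpos a ha)).congr ?_)
    filter_upwards [hev a ha] with z hz
    exact (congrArg Prod.fst ((isQPSolution_iff hΓ hp hθ hz).1 (hsol z hz))).symm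
  have hnear : ∀ a ∈ safeRegion f ψ α₁, ∀ᶠ z in 𝓝 a, h z < 0 →
      0 ≤ fderiv ℝ h z (closedLoop f g k z) := by
    intro a ha
    filter_upwards [hev a ha] with z hz hneg
    obtain ⟨⟨h1, h2, -⟩, -⟩ := hsol z hz
    have hαneg : α (h z) < 0 := hαK.2.2 ▸ hαK.2.1 hneg
    have : θ z * α (h z) ≤ 0 := mul_nonpos_of_nonneg_of_nonpos h2 hαneg.le
    rw [fderiv_closedLoop]
    simp only at h1
    linarith
  obtain ⟨T, x, hT, hx0, hx, hrem⟩ := exists_solvesODE_remainsIn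
    (isClosed_safeRegion hψ.continuous hh.continuous) hlip
    (fun T y hy h0 => hy.mem_safeRegion hψ hh hα₁K (hrel.2.1 0 le_rfl) hnear h0) hx₀
  refine ⟨T, x, hx0 ▸ RemainsIn.isTrajectory hT hx hrem fun t ht => ?_, hrem⟩
  obtain ⟨K, s, hs, hK⟩ := hlip _ (hrem.1 t ht)
  exact ⟨K, s, hs, Eventually.of_forall fun _ => hK⟩

end QP

end ODCBF

theorem mainTheorem8 {n m : ℕ}
    (f : ODCBF.E n → ODCBF.E n) (g : ODCBF.E n → ODCBF.E m →L[ℝ] ODCBF.E n)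
    (hf : LocallyLipschitz f) (hg : LocallyLipschitz g)
    (ψ : ODCBF.E n → ℝ) (hψ : ContDiff ℝ 1 ψ) (hLψ : ContDiff ℝ 1 (ODCBF.lieDeriv f ψ))
    (α₁ : ℝ → ℝ) (hα₁ : ContDiff ℝ 1 α₁)
    (hOD : ODCBF.IsODHOCBF f g ψ α₁)
    (hgrad : ∀ x, ψ x = 0 → ODCBF.hocbf f ψ α₁ x = 0 → fderiv ℝ ψ x ≠ 0) :
    ODCBF.IsSafeSet f g (ODCBF.superlevel ψ) (ODCBF.safeRegion f ψ α₁) ∧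
    ∀ (Γ : Matrix (Fin m) (Fin m) ℝ) (p θd : ℝ) (kd : ODCBF.E n → ODCBF.E m) (α : ℝ → ℝ),
      Γ.PosDef → 0 < p → 0 ≤ θd → LocallyLipschitz kd →
      ODCBF.IsExtClassK α → LocallyLipschitz α →
      LocallyLipschitz (fderiv ℝ (ODCBF.hocbf f ψ α₁)) →
      (∀ x ∈ ODCBF.safeRegion f ψ α₁,
        ∃! w, ODCBF.IsQPSolution f g (ODCBF.hocbf f ψ α₁) α kd Γ p θd x w) ∧
      ∀ (k : ODCBF.E n → ODCBF.E m) (θ : ODCBF.E n → ℝ),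
        ODCBF.IsQPController f g (ODCBF.hocbf f ψ α₁) α kd Γ p θd k θ →
        ODCBF.IsForwardInvariant (ODCBF.closedLoop f g k) (ODCBF.safeRegion f ψ α₁) := by
  have hh := ODCBF.contDiff_hocbf hψ hLψ hα₁
  refine ⟨⟨ODCBF.isControlInvariant_safeRegion hf hg hψ hLψ hα₁ hOD, inter_subset_left⟩, ?_⟩
  intro Γ p θd kd α hΓ hp hθ hkd hαK hα hdh
  refine ⟨fun x hx => ?_, fun k θ hk =>
    ODCBF.isForwardInvariant_safeRegion_of_isQPController hf hg hψ hh hOD hΓ hp hθ hkd hαK hα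
      hdh hk⟩
  obtain ⟨-, -, β, hβ, hcond⟩ := hOD
  have hpos := (ODCBF.qpSlack_pos_or_qpGain_pos (kd := kd) (θd := θd) hΓ hp hαK hβ.2.2
    (hcond x hx) hx.2).imp_left le_of_lt
  exact ⟨_, (ODCBF.isQPSolution_iff hΓ hp hθ hpos).2 rfl,
    fun _ hw => (ODCBF.isQPSolution_iff hΓ hp hθ hpos).1 hw⟩
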